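/- Let $\Gamma\subset\mathrm{SL}(2,\mathbb R)$ be a discrete subgroup with $-1\in\Gamma$ such that the hyperbolic surface $\mathcal Y=\Gamma\backslash\mathbb H$ has finite area, and let $\mathcal X=\Gamma\backslash\mathrm{SL}(2,\mathbb R)$ be its unit tangent bundle. Let $\mu$ be the Liouville measure on $\mathcal X$ normalised by $\mu(\mathcal X)=1$, that is, the projection to $\mathcal X$ of Haar measure on a fundamental domain of $\Gamma$ in $\mathrm{SL}(2,\mathbb R)$, the fundamental domain having mass one. For $x=\Gamma g\in\mathcal X$, define the geodesic flow and the unstable and stable horocycle flows by $$\varphi_t(x)=x\begin{pmatrix}e^{t/2}&0\\0&e^{-t/2}\end{pmatrix},\qquad h^+_s(x)=x\begin{pmatrix}1&0\\-s&1\end{pmatrix},\qquad h^-_s(x)=x\begin{pmatrix}1&s\\0&1\end{pmatrix}.$$ Let $K$ be the number of cusps of $\mathcal Y$. For $\kappa\in[K]=\{1,\dots,K\}$ let $\mathcal C_\kappa\subset\mathcal X$ be the closed stable horocycle of length one around the $\kappa$th cusp (its unit tangent vectors point towards the cusp, and its points have minimal period one under $h^-$), and fix $x_\kappa\in\mathcal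 C_\kappa$. For $\boldsymbol\sigma=(\sigma_1,\dots,\sigma_K)\in\mathbb R^K$ and $R\in\mathbb R$ put $$\mathcal H(\boldsymbol\sigma,R)=\bigcup_{\kappa=1}^K\{\varphi_t(y): y\in\mathcal C_\kappa,\ t\ge\sigma_\kappa+R\},\qquad \Sigma^K(\boldsymbol\sigma)=\{(s,t,\kappa): s\in[0,1),\ t\ge\sigma_\kappa,\ \kappa\in[K]\},$$ and parametrise $\mathcal H(\boldsymbol\sigma,R)$ by $\iota_{\boldsymbol\sigma,R}:\Sigma^K(\boldsymbol\sigma)\to\mathcal X$, $(s,t,\kappa)\mapsto\varphi_{t+R}\circ h^-_s(x_\kappa)$. For $x_0\in\mathcal X$ and $j=1,2,\dots$ let $\xi_j(x_0,\boldsymbol\sigma,R)\in(0,\infty]$ be the $j$th time $r>0$ at which $h^+_r(x_0)\in\mathcal H(\boldsymbol\sigma,R)$ (with $\xi_j=\infty$ if there are fewer than $j$ such times), and, if $\xi_j<\infty$, let $(w_j,\kappa_j)=(w_j(x_0,\boldsymbol\sigma,R),\kappa_j(x_0,\boldsymbol\sigma,R))\in\Sigma^K(\boldsymbol\sigma)$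 be the impact parameter and cusp label of the $j$th hit, defined by $\iota_{\boldsymbol\sigma,R}(w_j,\kappa_j)=h^+_{\xi_j}(x_0)$. A Borel probability measure $\lambda$ on $\mathcal X$ is called admissible if $\lim_{t\to\infty}\lambda(\varphi_t\mathcal E)=\mu(\mathcal E)$ for every Borel set $\mathcal E\subset\mathcal X$ with $\mu(\partial\mathcal E)=0$. **Theorem.** Assume that $\lambda$ is admissible, and fix $\boldsymbol\sigma\in\mathbb R^K$. Then, for $N\in\mathbb N$, $k_1,\dots,k_N\in\mathbb Z_{\ge0}$, $0<T_1\le\dots\le T_N$, and Borel sets $\mathcal D_1,\dots,\mathcal D_N\subset\Sigma^K(\boldsymbol\sigma)$ with boundary of Lebesgue measure zero, $$\lim_{R\to\infty}\lambda\bigl\{x_0\in\mathcal X:\ \#\{j: e^{-R}\xi_j(x_0,\boldsymbol\sigma,R)\le T_i,\ (w_j(x_0,\boldsymbol\sigma,R),\kappa_j(x_0,\boldsymbol\sigma,R))\in\mathcal D_i\}=k_i\ \ \forall i\le N\bigr\}$$ $$=\mu\bigl\{x\in\mathcal X:\ \#\{j: \xi_j(x,\boldsymbol\sigma,0)\le T_i,\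 (w_j(x,\boldsymbol\sigma,0),\kappa_j(x,\boldsymbol\sigma,0))\in\mathcal D_i\}=k_i\ \ \forall i\le N\bigr\}.$$ -/

import Mathlib

open Set Filter Topology MeasureTheory

namespace HorocycleFlow

noncomputable section

/-- The group `SL(2, ℝ)`, with its usual topology and its Borel σ-algebra. -/
abbrev SL2R : Type := Matrix.SpecialLinearGroup (Fin 2) ℝ

instance instMeasurableSpaceSL2R : MeasurableSpace SL2R := borel SL2R

instance instBorelSpaceSL2R : BorelSpace SL2R := ⟨rfl⟩

/-- The diagonal matrix with entries `exp (t / 2)`, `exp (-t / 2)`. -/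
def geodesicMatrix (t : ℝ) : SL2R :=
  ⟨!![Real.exp (t / 2), 0; 0, Real.exp (-t / 2)], by
    rw [Matrix.det_fin_two_of, ← Real.exp_add]
    ring_nf
    simp⟩

/-- The lower triangular unipotent matrix with lower left entry `-s`. -/
def unstableMatrix (s : ℝ) : SL2R :=
  ⟨!![1, 0; -s, 1], by simp [Matrix.det_fin_two_of]⟩

/-- The upper triangular unipotent matrix with upper right entry `s`. -/
def stableMatrix (s : ℝ) : SL2R :=
  ⟨!![1, s; 0, 1], by simp [Matrix.det_fin_two_of]⟩

/-- The space `𝒳 = Γ \ SL(2, ℝ)` of cosets `Γ g`. If `Γ` is discrete and contains `-1`, this is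
the unit tangent bundle of the hyperbolic surface `𝒴 = Γ \ ℍ`. -/
def UnitTangent (Γ : Subgroup SL2R) : Type := Quotient (MulAction.orbitRel Γ SL2R)

variable (Γ : Subgroup SL2R)

/-- The quotient topology. -/
instance instTopologicalSpaceUnitTangent : TopologicalSpace (UnitTangent Γ) :=
  inferInstanceAs (TopologicalSpace (Quotient (MulAction.orbitRel Γ SL2R)))

/-- The Borel σ-algebra. -/
instance instMeasurableSpaceUnitTangent : MeasurableSpace (UnitTangent Γ) :=
  borel (UnitTangent Γ)

instance instBorelSpaceUnitTangent : BorelSpace (UnitTangent Γ) := ⟨rfl⟩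

/-- The projection `g ↦ Γ g`. -/
def proj (g : SL2R) : UnitTangent Γ := Quotient.mk (MulAction.orbitRel Γ SL2R) g

variable {Γ}

/-- Right translation `Γ g ↦ Γ g h`. -/
def rightTranslate (h : SL2R) : UnitTangent Γ → UnitTangent Γ :=
  Quotient.map (fun g => g * h) (by
    rintro _ b ⟨γ, rfl⟩
    exact ⟨γ, (smul_mul_assoc γ b h).symm⟩)

/-- The geodesic flow `φ_t`. -/
def geodesicFlow (t : ℝ) : UnitTangent Γ → UnitTangent Γ := rightTranslate (geodesicMatrix t)

/-- The unstable horocycle flow `h⁺_s`. -/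
def unstableFlow (s : ℝ) : UnitTangent Γ → UnitTangent Γ := rightTranslate (unstableMatrix s)

/-- The stable horocycle flow `h⁻_s`. -/
def stableFlow (s : ℝ) : UnitTangent Γ → UnitTangent Γ := rightTranslate (stableMatrix s)

variable (Γ) in
/-- `μ` is the normalised Liouville measure on `Γ \ SL(2, ℝ)`: the projection of the restriction
to a fundamental domain of `Γ` of the Haar measure that gives this fundamental domain mass one.
(Such a measure exists if and only if the surface `Γ \ ℍ` has finite area.) -/
def IsLiouville (μ : Measure (UnitTangent Γ)) : Prop :=
  ∃ (haar : Measure SL2R) (F : Set SL2R), haar.IsHaarMeasure ∧ IsFundamentalDomain Γ F haar ∧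
    haar F = 1 ∧ μ = (haar.restrict F).map (proj Γ)

/-- Admissible initial distributions: `lam (φ_t E) → μ E` as `t → ∞` for every Borel set `E` with
boundary of `μ`-measure zero. -/
def Admissible (μ lam : Measure (UnitTangent Γ)) : Prop :=
  ∀ E : Set (UnitTangent Γ), MeasurableSet E → μ (frontier E) = 0 →
    Tendsto (fun t : ℝ => lam (geodesicFlow t '' E)) atTop (𝓝 (μ E))

variable (Γ) in
/-- `c 0, …, c (K - 1)` is a complete list of the cusps of the surface `Γ \ ℍ`, each listed once,
i.e. a system of representatives of the `Γ`-orbits of fixed points of parabolic elements. -/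
structure IsCuspSystem {K : ℕ} (c : Fin K → OnePoint ℝ) : Prop where
  isCusp : ∀ κ, IsCusp (c κ) (Γ.map Matrix.SpecialLinearGroup.toGL)
  existsUnique : ∀ c' : OnePoint ℝ, IsCusp c' (Γ.map Matrix.SpecialLinearGroup.toGL) →
    ∃! κ, ∃ γ ∈ Γ, Matrix.SpecialLinearGroup.toGL γ • c' = c κ

/-- `x` lies on the closed stable horocycle of length one around the cusp `c`: the unit tangent
vector `x = Γ g` points to the cusp `c = g ∞`, and its orbit under the stable horocycle flow is
periodic with minimal period one. -/
def OnUnitHorocycle (c : OnePoint ℝ) (x : UnitTangent Γ) : Prop :=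
  (∃ g : SL2R, proj Γ g = x ∧ Matrix.SpecialLinearGroup.toGL g • OnePoint.infty = c) ∧
    ∀ s : ℝ, stableFlow s x = x ↔ ∃ m : ℤ, s = m

/-- The stable horocycle through `x`. -/
def stableHorocycle (x : UnitTangent Γ) : Set (UnitTangent Γ) := range fun s : ℝ => stableFlow s x

/-- The section `⋃_{t ≥ R} φ_t 𝒞` above the stable horocycle `𝒞` through `x`. -/
def cuspSection (x : UnitTangent Γ) (R : ℝ) : Set (UnitTangent Γ) :=
  {y | ∃ t ≥ R, y ∈ geodesicFlow t '' stableHorocycle x}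

variable {K : ℕ}

/-- The multi-cusp section `ℋ(σ, R)`, the union over `κ` of the sections at height `σ κ + R`. -/
def multiSection (x : Fin K → UnitTangent Γ) (σ : Fin K → ℝ) (R : ℝ) : Set (UnitTangent Γ) :=
  ⋃ κ, cuspSection (x κ) (σ κ + R)

/-- The parameter space `Σ^K(σ)` of triples `(s, t, κ)` with `0 ≤ s < 1` and `t ≥ σ κ`. -/
def sectionParam (σ : Fin K → ℝ) : Set (ℝ × ℝ × Fin K) :=
  {p | p.1 ∈ Ico (0 : ℝ) 1 ∧ σ p.2.2 ≤ p.2.1}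

/-- The parametrisation `(s, t, κ) ↦ φ_{t + R} (h⁻_s (x κ))` of the section `ℋ(σ, R)`. -/
def sectionEmbed (x : Fin K → UnitTangent Γ) (R : ℝ) (p : ℝ × ℝ × Fin K) : UnitTangent Γ :=
  geodesicFlow (p.2.1 + R) (stableFlow p.1 (x p.2.2))

/-- The `j`-th hitting time `ξ_j`, `j = 1, 2, …`, of the section `ℋ(σ, R)` for the orbit of `x₀`
under the unstable horocycle flow, counted from time `0` on (the value at `j = 0` is the starting
time `0`); it is `⊤` if there are fewer than `j` hits. -/
def hittingTime (x : Fin K → UnitTangent Γ) (σ : Fin K → ℝ) (R : ℝ) (x₀ : UnitTangent Γ) :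
    ℕ → EReal
  | 0 => 0
  | j + 1 => sInf {ξ : EReal | ∃ r : ℝ, ξ = r ∧ hittingTime x σ R x₀ j < r ∧
      unstableFlow r x₀ ∈ multiSection x σ R}

/-- `p = (w, κ) ∈ Σ^K(σ)` is the impact parameter `(w_j, κ_j)` of the `j`-th hit: the location of
the `j`-th hit on `ℋ(σ, R)` is the point with coordinates `p`. -/
def IsImpact (x : Fin K → UnitTangent Γ) (σ : Fin K → ℝ) (R : ℝ) (x₀ : UnitTangent Γ) (j : ℕ)
    (p : ℝ × ℝ × Fin K) : Prop :=
  p ∈ sectionParam σ ∧ ∃ r : ℝ, hittingTime x σ R x₀ j = r ∧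
    sectionEmbed x R p = unstableFlow r x₀

/-- The number of `j = 1, 2, …` with `e^{-R} ξ_j(x₀, σ, R) ≤ T` and
`(w_j(x₀, σ, R), κ_j(x₀, σ, R)) ∈ D`. -/
def hitCount (x : Fin K → UnitTangent Γ) (σ : Fin K → ℝ) (R : ℝ) (T : ℝ)
    (D : Set (ℝ × ℝ × Fin K)) (x₀ : UnitTangent Γ) : ℕ∞ :=
  {j : ℕ | 1 ≤ j ∧ (Real.exp (-R) : EReal) * hittingTime x σ R x₀ j ≤ (T : EReal) ∧
    ∃ p ∈ D, IsImpact x σ R x₀ j p}.encard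

/-- Lebesgue measure on `ℝ × ℝ × {1, …, K}`: two-dimensional Lebesgue measure on each of the `K`
sheets. -/
def sheetVolume (K : ℕ) : Measure (ℝ × ℝ × Fin K) :=
  (volume : Measure ℝ).prod ((volume : Measure ℝ).prod Measure.count)

end

end HorocycleFlow

open HorocycleFlow

/-! The proof is a renormalisation. The flow `geodesicFlow R` carries the section at height `0` to
the section at height `R`, preserves impact parameters, and stretches unstable horocycle time by
`exp R`. So the event at height `R` is exactly the image under `geodesicFlow R` of the limiting
event `E` (`hitCount_geodesicFlow`), and admissibility gives the limit once `E` has a `μ`-null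
boundary.

For the boundary, lift to the group. If `x κ` is the coset of `w κ`, a hit by the orbit of `Γ g` is
a matrix `m = (w κ)⁻¹ γ g` of the form `n₋(s) a(t) n₊(-r)`. This form exists exactly when `m 1 1 >
0`, and `s`, `t`, `r` are explicit in the entries of `m`. Discreteness of `Γ` makes the bottom rows
of `(w κ)⁻¹ γ` locally finite (`finite_bottomRow`), so finitely many `γ` matter near `g`. The counts
are then constant near `g` unless some `m` lies in `exceptionalSet`
(`eventually_encard_hitTimesIn_eq`). That set is Haar-null and `Γ` is countable, so almost every `g`
is good. -/

namespace HorocycleFlow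

noncomputable section

/-! ### Counting hits by times instead of indices. -/

section HittingTimes

variable {Γ : Subgroup SL2R} {K : ℕ} {x : Fin K → UnitTangent Γ} {σ : Fin K → ℝ} {R : ℝ}
  {x₀ : UnitTangent Γ}

/-- The set of times at which the orbit of `x₀` under the unstable horocycle flow hits `ℋ(σ, R)`. -/
def hitTimes (x : Fin K → UnitTangent Γ) (σ : Fin K → ℝ) (R : ℝ) (x₀ : UnitTangent Γ) : Set ℝ :=
  {r | unstableFlow r x₀ ∈ multiSection x σ R}

/-- The set of positive rescaled times `≤ T` at which the orbit hits the section in a point with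
coordinates in `D`. -/
def hitTimesIn (x : Fin K → UnitTangent Γ) (σ : Fin K → ℝ) (R : ℝ) (T : ℝ)
    (D : Set (ℝ × ℝ × Fin K)) (x₀ : UnitTangent Γ) : Set ℝ :=
  {r | 0 < r ∧ Real.exp (-R) * r ≤ T ∧
    ∃ p ∈ D, p ∈ sectionParam σ ∧ sectionEmbed x R p = unstableFlow r x₀}

lemma le_hittingTime_succ (j : ℕ) :
    hittingTime x σ R x₀ j ≤ hittingTime x σ R x₀ (j + 1) := by
  rw [hittingTime]
  refine le_sInf ?_
  rintro _ ⟨r, rfl, hr, -⟩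
  exact hr.le

lemma hittingTime_monotone : Monotone (hittingTime x σ R x₀) :=
  monotone_nat_of_le_succ le_hittingTime_succ

lemma hittingTime_nonneg (j : ℕ) : 0 ≤ hittingTime x σ R x₀ j :=
  hittingTime_monotone (Nat.zero_le j)

lemma hittingTime_succ_le {j : ℕ} {r : ℝ} (hr : r ∈ hitTimes x σ R x₀)
    (h : hittingTime x σ R x₀ j < r) : hittingTime x σ R x₀ (j + 1) ≤ r := by
  rw [hittingTime]
  exact sInf_le ⟨r, rfl, h, hr⟩

/-- Local finiteness turns the defining infimum into a minimum, unless no hit remains. -/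
lemma hittingTime_succ_eq (hfin : ∀ B, (hitTimes x σ R x₀ ∩ Icc 0 B).Finite) (j : ℕ) :
    hittingTime x σ R x₀ (j + 1) = ⊤ ∨ ∃ r ∈ hitTimes x σ R x₀,
      hittingTime x σ R x₀ (j + 1) = r ∧ hittingTime x σ R x₀ j < r := by
  by_cases hne : ∃ r ∈ hitTimes x σ R x₀, hittingTime x σ R x₀ j < r
  · right
    obtain ⟨r₁, hr₁, hlt⟩ := hne
    have hf : {r | r ∈ hitTimes x σ R x₀ ∧ hittingTime x σ R x₀ j < r ∧ r ≤ r₁}.Finite := by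
      refine (hfin r₁).subset ?_
      rintro r ⟨h1, h2, h3⟩
      exact ⟨h1, by exact_mod_cast (hittingTime_nonneg j).trans h2.le, h3⟩
    obtain ⟨m, hm⟩ := hf.exists_minimal ⟨r₁, hr₁, hlt, le_rfl⟩
    refine ⟨m, hm.prop.1, le_antisymm (hittingTime_succ_le hm.prop.1 hm.prop.2.1) ?_, hm.prop.2.1⟩
    rw [hittingTime]
    refine le_sInf ?_
    rintro _ ⟨r, rfl, h1, h2⟩
    rw [EReal.coe_le_coe_iff]
    by_contra! hlt'
    exact absurd (hm.le_of_le ⟨h2, h1, hlt'.le.trans hm.prop.2.2⟩ hlt'.le) (not_le.2 hlt')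
  · left
    rw [hittingTime, eq_top_iff]
    refine le_sInf ?_
    rintro _ ⟨r, rfl, h1, h2⟩
    exact absurd ⟨r, h2, h1⟩ hne

lemma hittingTime_lt (hfin : ∀ B, (hitTimes x σ R x₀ ∩ Icc 0 B).Finite) {i j : ℕ} (hij : i < j)
    (hj : hittingTime x σ R x₀ j ≠ ⊤) : hittingTime x σ R x₀ i < hittingTime x σ R x₀ j := by
  obtain ⟨j, rfl⟩ := Nat.exists_eq_add_one_of_ne_zero (Nat.ne_zero_of_lt hij)
  obtain h | ⟨r, -, h1, h2⟩ := hittingTime_succ_eq hfin j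
  · exact absurd h hj
  · rw [h1]
    exact (hittingTime_monotone (Nat.lt_succ_iff.1 hij)).trans_lt h2

/-- If the recursion missed `r`, every `hittingTime` would stay below `r`, giving infinitely many
distinct hits in `[0, r]`. -/
lemma exists_hittingTime_eq (hfin : ∀ B, (hitTimes x σ R x₀ ∩ Icc 0 B).Finite) {r : ℝ}
    (hr : r ∈ hitTimes x σ R x₀) (h0 : 0 < r) :
    ∃ j, 1 ≤ j ∧ hittingTime x σ R x₀ j = r := by
  by_contra! hne
  have hlt : ∀ j, hittingTime x σ R x₀ j < r := by
    intro j
    induction j with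
    | zero => simpa [hittingTime] using h0
    | succ j ih => exact lt_of_le_of_ne (hittingTime_succ_le hr ih) (hne _ (by omega))
  have htop : ∀ j, hittingTime x σ R x₀ j ≠ ⊤ := fun j => ((hlt j).trans_le le_top).ne
  have hex : ∀ j, ∃ s ∈ hitTimes x σ R x₀ ∩ Icc 0 r, hittingTime x σ R x₀ (j + 1) = s := by
    intro j
    obtain h | ⟨s, hs, h1, -⟩ := hittingTime_succ_eq hfin j
    · exact absurd h (htop _)
    · refine ⟨s, ⟨hs, ?_, ?_⟩, h1⟩
      · exact_mod_cast h1 ▸ hittingTime_nonneg (j + 1)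
      · exact_mod_cast h1 ▸ (hlt (j + 1)).le
  choose f hf hf' using hex
  have hinj : Function.Injective f := by
    refine StrictMono.injective (fun i j hij => ?_)
    have := hittingTime_lt hfin (Nat.succ_lt_succ hij) (htop _)
    rw [Nat.succ_eq_add_one, Nat.succ_eq_add_one, hf', hf'] at this
    exact_mod_cast this
  exact Set.infinite_range_of_injective hinj ((hfin r).subset (by rintro _ ⟨j, rfl⟩; exact hf j))

lemma sectionEmbed_mem_multiSection {p : ℝ × ℝ × Fin K} (hp : p ∈ sectionParam σ) :
    sectionEmbed x R p ∈ multiSection x σ R :=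
  mem_iUnion.2 ⟨p.2.2, p.2.1 + R, add_le_add_left hp.2 R, _, ⟨p.1, rfl⟩, rfl⟩

/-- Where finite, the hitting times are strictly increasing in the index, and they exhaust the
positive hits. The recursion can thus be replaced by a plain set of real numbers. -/
lemma hitCount_eq_encard (hfin : ∀ B, (hitTimes x σ R x₀ ∩ Icc 0 B).Finite) (T : ℝ)
    (D : Set (ℝ × ℝ × Fin K)) :
    hitCount x σ R T D x₀ = (hitTimesIn x σ R T D x₀).encard := by
  rw [hitCount]
  set J := {j : ℕ | 1 ≤ j ∧ (Real.exp (-R) : EReal) * hittingTime x σ R x₀ j ≤ (T : EReal) ∧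
    ∃ p ∈ D, IsImpact x σ R x₀ j p}
  have hJ : ∀ j ∈ J, hittingTime x σ R x₀ j = (hittingTime x σ R x₀ j).toReal := by
    rintro j ⟨-, -, p, -, -, r, hr, -⟩
    rw [hr, EReal.toReal_coe]
  have hinj : InjOn (fun j => (hittingTime x σ R x₀ j).toReal) J := by
    intro i hi j hj hij
    have h : hittingTime x σ R x₀ i = hittingTime x σ R x₀ j := by
      rw [hJ i hi, hJ j hj]
      exact congrArg _ hij
    have htop : ∀ j ∈ J, hittingTime x σ R x₀ j ≠ ⊤ := fun j hj => by
      rw [hJ j hj]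
      exact EReal.coe_ne_top _
    by_contra hne
    obtain h' | h' := lt_or_gt_of_ne hne
    · exact (hittingTime_lt hfin h' (htop j hj)).ne h
    · exact (hittingTime_lt hfin h' (htop i hi)).ne h.symm
  rw [← hinj.encard_image]
  congr 1
  ext r
  constructor
  · rintro ⟨j, ⟨h1, h2, p, hpD, hp, r, hr, he⟩, rfl⟩
    simp only [hr, EReal.toReal_coe] at h2 ⊢
    refine ⟨?_, by exact_mod_cast h2, p, hpD, hp, he⟩
    have h3 := hittingTime_lt (i := 0) hfin h1 (by rw [hr]; exact EReal.coe_ne_top _)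
    rw [hr, hittingTime] at h3
    exact_mod_cast h3
  · rintro ⟨h0, hT, p, hpD, hp, he⟩
    obtain ⟨j, hj1, hj⟩ := exists_hittingTime_eq hfin
      (by rw [hitTimes, mem_ofPred_eq, ← he]; exact sectionEmbed_mem_multiSection hp) h0
    refine ⟨j, ⟨hj1, ?_, p, hpD, hp, r, hj, he⟩, by simp [hj]⟩
    rw [hj]
    exact_mod_cast hT

end HittingTimes

/-! ### Haar-null subsets of `SL2R`. -/

section NullSets

instance instSecondCountableTopologySL2R : SecondCountableTopology SL2R :=
  have : SecondCountableTopology (Matrix (Fin 2) (Fin 2) ℝ) :=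
    inferInstanceAs (SecondCountableTopology (Fin 2 → Fin 2 → ℝ))
  Matrix.SpecialLinearGroup.isClosedEmbedding_val.isEmbedding.secondCountableTopology

instance instLocallyCompactSpaceSL2R : LocallyCompactSpace SL2R :=
  have : LocallyCompactSpace (Matrix (Fin 2) (Fin 2) ℝ) :=
    inferInstanceAs (LocallyCompactSpace (Fin 2 → Fin 2 → ℝ))
  Matrix.SpecialLinearGroup.isClosedEmbedding_val.locallyCompactSpace

@[simp] lemma mul_entry (g h : SL2R) (i j : Fin 2) :
    (g * h) i j = g i 0 * h 0 j + g i 1 * h 1 j := by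
  rw [Matrix.SpecialLinearGroup.coe_mul, Matrix.mul_apply, Fin.sum_univ_two]

lemma det_entry (g : SL2R) : g 0 0 * g 1 1 - g 0 1 * g 1 0 = 1 := by
  rw [← Matrix.det_fin_two, g.det_coe]

@[simp] lemma geodesicMatrix_zero_zero (t : ℝ) : geodesicMatrix t 0 0 = Real.exp (t / 2) := rfl
@[simp] lemma geodesicMatrix_zero_one (t : ℝ) : geodesicMatrix t 0 1 = 0 := rfl
@[simp] lemma geodesicMatrix_one_zero (t : ℝ) : geodesicMatrix t 1 0 = 0 := rfl
@[simp] lemma geodesicMatrix_one_one (t : ℝ) : geodesicMatrix t 1 1 = Real.exp (-t / 2) := rfl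
@[simp] lemma unstableMatrix_zero_zero (s : ℝ) : unstableMatrix s 0 0 = 1 := rfl
@[simp] lemma unstableMatrix_zero_one (s : ℝ) : unstableMatrix s 0 1 = 0 := rfl
@[simp] lemma unstableMatrix_one_zero (s : ℝ) : unstableMatrix s 1 0 = -s := rfl
@[simp] lemma unstableMatrix_one_one (s : ℝ) : unstableMatrix s 1 1 = 1 := rfl
@[simp] lemma stableMatrix_zero_zero (s : ℝ) : stableMatrix s 0 0 = 1 := rfl
@[simp] lemma stableMatrix_zero_one (s : ℝ) : stableMatrix s 0 1 = s := rfl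
@[simp] lemma stableMatrix_one_zero (s : ℝ) : stableMatrix s 1 0 = 0 := rfl
@[simp] lemma stableMatrix_one_one (s : ℝ) : stableMatrix s 1 1 = 1 := rfl

lemma SL2R_ext {g h : SL2R} (h00 : g 0 0 = h 0 0) (h01 : g 0 1 = h 0 1) (h10 : g 1 0 = h 1 0)
    (h11 : g 1 1 = h 1 1) : g = h := by
  refine Matrix.SpecialLinearGroup.ext _ _ fun i j => ?_
  fin_cases i <;> fin_cases j <;> assumption

lemma continuous_entry (i j : Fin 2) : Continuous fun g : SL2R => g i j := by fun_prop

lemma continuous_SL2R_iff {α : Type*} [TopologicalSpace α] {f : α → SL2R} :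
    Continuous f ↔ ∀ i j, Continuous fun a => f a i j := by
  refine ⟨fun h i j => (continuous_entry i j).comp h, fun h => ?_⟩
  exact Matrix.SpecialLinearGroup.isClosedEmbedding_val.continuous_iff.2 (continuous_matrix h)

lemma continuous_unstableMatrix : Continuous unstableMatrix := by
  refine continuous_SL2R_iff.2 fun i j => ?_
  fin_cases i <;> fin_cases j <;> simp <;> fun_prop

lemma continuous_stableMatrix : Continuous stableMatrix := by
  refine continuous_SL2R_iff.2 fun i j => ?_
  fin_cases i <;> fin_cases j <;> simp <;> fun_prop

lemma continuous_geodesicMatrix : Continuous geodesicMatrix := by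
  refine continuous_SL2R_iff.2 fun i j => ?_
  fin_cases i <;> fin_cases j <;> simp <;> fun_prop

/-- A measurable set is null for a left invariant measure if, for some family of group elements
parametrised by a nonzero measure space, almost no left translate of a given point lies in it. -/
lemma measure_eq_zero_of_translates {G α : Type*} [Group G] [MeasurableSpace G] [MeasurableMul G]
    [MeasurableSpace α] {ν : Measure G} [SFinite ν] [ν.IsMulLeftInvariant] {ρ : Measure α}
    [SFinite ρ] (hρ : ρ ≠ 0) {f : α → G} (hf : Measurable fun q : α × G => f q.1 * q.2)
    {B : Set G} (hB : MeasurableSet B) (h : ∀ g, ρ {a | f a * g ∈ B} = 0) : ν B = 0 := by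
  have hS : MeasurableSet ((fun q : α × G => f q.1 * q.2) ⁻¹' B) := hf hB
  have h1 : (ρ.prod ν) ((fun q : α × G => f q.1 * q.2) ⁻¹' B) = 0 := by
    rw [Measure.prod_apply_symm hS]
    simp only [lintegral_eq_zero_iff (measurable_measure_prodMk_right hS)]
    exact Eventually.of_forall fun g => h g
  rw [Measure.measure_prod_null hS] at h1
  have : NeZero ρ := ⟨hρ⟩
  obtain ⟨a, ha⟩ := h1.exists
  have : ν ((fun g => f a * g) ⁻¹' B) = 0 := ha
  rwa [measure_preimage_mul] at this

variable (ν : Measure SL2R) [ν.IsHaarMeasure]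

/-- Along left translates by `unstableMatrix s` the expression is affine in `s`. Two zeros would
make both rows of `g` annihilate `z`, which is impossible for determinant one. -/
lemma measure_row_one_eq_zero {z : ℝ × ℝ} (hz : z ≠ 0) :
    ν {g | g 1 0 * z.1 + g 1 1 * z.2 = 0} = 0 := by
  refine measure_eq_zero_of_translates (ρ := (volume : Measure ℝ)) (NeZero.ne _)
    (f := unstableMatrix) ?_ ?_ fun g => ?_
  · exact ((continuous_unstableMatrix.comp continuous_fst).mul continuous_snd).measurable
  · refine (isClosed_eq ?_ continuous_const).measurableSet
    exact ((continuous_entry 1 0).mul continuous_const).add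
      ((continuous_entry 1 1).mul continuous_const)
  · refine Set.Subsingleton.measure_zero ?_ _
    have hdet := det_entry g
    intro s hs t ht
    simp only [mem_ofPred_eq, mul_entry, unstableMatrix_one_zero, unstableMatrix_one_one] at hs ht
    by_contra hne
    have h1 : g 0 0 * z.1 + g 0 1 * z.2 = 0 := by
      have : (s - t) * (g 0 0 * z.1 + g 0 1 * z.2) = 0 := by linear_combination ht - hs
      exact (mul_eq_zero.1 this).resolve_left (sub_ne_zero.2 hne)
    have h2 : g 1 0 * z.1 + g 1 1 * z.2 = 0 := by linear_combination hs + s * h1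
    refine hz (Prod.ext ?_ ?_)
    · show z.1 = 0
      linear_combination g 1 1 * h1 - g 0 1 * h2 - z.1 * hdet
    · show z.2 = 0
      linear_combination g 0 0 * h2 - g 1 0 * h1 - z.2 * hdet

/-- The coordinates `(s, t)` of an element `n₋(s) a(t) n₊(-r)` of `SL(2, ℝ)`. -/
def sectionCoord (g : SL2R) : ℝ × ℝ := (g 0 1 / g 1 1, -2 * Real.log (g 1 1))

lemma measurable_sectionCoord : Measurable sectionCoord :=
  ((continuous_entry 0 1).measurable.div (continuous_entry 1 1).measurable).prodMk
    ((Real.measurable_log.comp (continuous_entry 1 1).measurable).const_mul _)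

/-- For fixed `g` with `g 1 1 > 0`, the coordinates of `n₋(q.2) a(q.1) g` are, up to a swap, a shear
and translation of `q`. This map preserves Lebesgue measure, so almost every translate avoids the
set. -/
lemma measure_sectionCoord_mem_eq_zero {A : Set (ℝ × ℝ)} (hA : volume A = 0) :
    ν {g | 0 < g 1 1 ∧ sectionCoord g ∈ A} = 0 := by
  obtain ⟨A', hAA', hA'm, hA'⟩ := exists_measurable_superset_of_null hA
  refine measure_mono_null (t := {g | 0 < g 1 1 ∧ sectionCoord g ∈ A'})
    (fun g hg => ⟨hg.1, hAA' hg.2⟩) ?_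
  refine measure_eq_zero_of_translates (ρ := (volume : Measure (ℝ × ℝ))) (NeZero.ne _)
    (f := fun q => stableMatrix q.2 * geodesicMatrix q.1) ?_ ?_ fun g => ?_
  · exact (((continuous_stableMatrix.comp (by fun_prop)).mul
      (continuous_geodesicMatrix.comp (by fun_prop))).mul continuous_snd).measurable
  · exact (measurableSet_lt measurable_const (continuous_entry 1 1).measurable).inter
      (measurable_sectionCoord hA'm)
  · have key : ∀ q : ℝ × ℝ, (stableMatrix q.2 * geodesicMatrix q.1 * g) 1 1 =
        Real.exp (-q.1 / 2) * g 1 1 ∧ (stableMatrix q.2 * geodesicMatrix q.1 * g) 0 1 =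
        Real.exp (q.1 / 2) * g 0 1 + q.2 * Real.exp (-q.1 / 2) * g 1 1 := by
      intro q
      constructor <;> simp
    by_cases hg : 0 < g 1 1
    · have hmp : MeasurePreserving (fun q : ℝ × ℝ =>
          (q.1 + (sectionCoord g).2, q.2 + Real.exp q.1 * (sectionCoord g).1))
          ((volume : Measure ℝ).prod volume) ((volume : Measure ℝ).prod volume) :=
        (measurePreserving_add_right volume _).skew_product
          (g := fun t s => s + Real.exp t * (sectionCoord g).1) (by fun_prop)
          (Eventually.of_forall fun t => (measurePreserving_add_right volume _).map_eq)
      have hsw : MeasurePreserving _ (volume : Measure (ℝ × ℝ)) volume := (Measure.measurePreserving_swap (μ := (volume : Measure ℝ))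
        (ν := (volume : Measure ℝ))).comp hmp
      rw [← hA', ← hsw.measure_preimage hA'm.nullMeasurableSet]
      congr 1
      ext q
      have hpos : 0 < Real.exp (-q.1 / 2) * g 1 1 := mul_pos (Real.exp_pos _) hg
      have h1 : sectionCoord (stableMatrix q.2 * geodesicMatrix q.1 * g) =
          (q.2 + Real.exp q.1 * (sectionCoord g).1, q.1 + (sectionCoord g).2) := by
        refine Prod.ext ?_ ?_
        · simp only [sectionCoord, (key q).1, (key q).2]
          have : Real.exp (q.1 / 2) = Real.exp q.1 * Real.exp (-q.1 / 2) := by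
            rw [← Real.exp_add]; ring_nf
          rw [this]
          field_simp
          ring
        · simp only [sectionCoord, (key q).1]
          rw [Real.log_mul (Real.exp_ne_zero _) hg.ne', Real.log_exp]
          ring
      simp only [mem_ofPred_eq, mem_preimage, h1, (key q).1, hpos, true_and, Function.comp,
        Prod.swap]
    · convert measure_empty (μ := (volume : Measure (ℝ × ℝ)))
      refine Set.eq_empty_of_forall_notMem fun q hq => hg ?_
      have := hq.1
      rw [(key q).1] at this
      exact pos_of_mul_pos_right this (Real.exp_pos _).le

end NullSets

/-! ### Local finiteness of bottom rows. -/

section LatticeRows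

variable {Γ : Subgroup SL2R}

lemma proj_surjective : Function.Surjective (proj Γ) := Quotient.mk_surjective

lemma proj_eq_proj {g h : SL2R} : proj Γ g = proj Γ h ↔ ∃ γ ∈ Γ, γ * h = g := by
  refine (Quotient.eq (r := MulAction.orbitRel Γ SL2R)).trans ?_
  rw [MulAction.orbitRel_apply, MulAction.mem_orbit_iff]
  exact ⟨fun ⟨γ, hγ⟩ => ⟨γ, γ.2, hγ⟩, fun ⟨γ, h1, h2⟩ => ⟨⟨γ, h1⟩, h2⟩⟩

lemma rightTranslate_proj (h g : SL2R) : rightTranslate h (proj Γ g) = proj Γ (g * h) := rfl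

lemma stableFlow_proj_eq_iff {s : ℝ} {w : SL2R} :
    stableFlow s (proj Γ w) = proj Γ w ↔ w * stableMatrix s * w⁻¹ ∈ Γ := by
  rw [stableFlow, rightTranslate_proj, proj_eq_proj]
  constructor
  · rintro ⟨γ, hγ, h⟩
    rwa [← h, mul_inv_cancel_right]
  · intro h
    exact ⟨_, h, by group⟩

/-- The bottom row of a matrix in `SL(2, ℝ)`. -/
def bottomRow (g : SL2R) : ℝ × ℝ := (g 1 0, g 1 1)

lemma finite_inter_of_isCompact [DiscreteTopology Γ] {C : Set SL2R} (hC : IsCompact C) :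
    ((Γ : Set SL2R) ∩ C).Finite :=
  (hC.inter_left Subgroup.isClosed_of_discrete).finite
    (DiscreteTopology.isDiscrete.mono inter_subset_left)

lemma isCompact_entries_le (B : ℝ) : IsCompact {g : SL2R | ∀ i j, |g i j| ≤ B} := by
  have h : IsCompact (Set.pi univ fun _ => Set.pi univ fun _ => Icc (-B) B :
      Set (Fin 2 → Fin 2 → ℝ)) :=
    isCompact_univ_pi fun _ => isCompact_univ_pi fun _ => isCompact_Icc
  have heq : {g : SL2R | ∀ i j, |g i j| ≤ B} = (fun g : SL2R => (g : Matrix (Fin 2) (Fin 2) ℝ)) ⁻¹'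
      (Set.pi univ fun _ => Set.pi univ fun _ => Icc (-B) B : Set (Fin 2 → Fin 2 → ℝ)) := by
    ext g
    simp only [mem_ofPred_eq, abs_le]
    exact ⟨fun h i _ j _ => h i j, fun h i j => h i trivial j trivial⟩
  rw [heq]
  exact Matrix.SpecialLinearGroup.isClosedEmbedding_val.isCompact_preimage h

lemma inv_entries (g : SL2R) : g⁻¹ 0 0 = g 1 1 ∧ g⁻¹ 0 1 = -g 0 1 ∧ g⁻¹ 1 0 = -g 1 0 ∧
    g⁻¹ 1 1 = g 0 0 := by
  simp [Matrix.SpecialLinearGroup.coe_inv, Matrix.adjugate_fin_two]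

/-- The conjugate depends only on the bottom row of `M`, so discreteness of `Γ` can be transferred
to rows. -/
lemma conj_stableMatrix_one (M : SL2R) (i j : Fin 2) :
    (M⁻¹ * stableMatrix 1 * M) i j =
      !![1 + M 1 0 * M 1 1, M 1 1 ^ 2; -M 1 0 ^ 2, 1 - M 1 0 * M 1 1] i j := by
  obtain ⟨h00, h01, h10, h11⟩ := inv_entries M
  have := det_entry M
  fin_cases i <;> fin_cases j <;> simp [h00, h01, h10, h11] <;>
    first | linear_combination this | ring

/-- If `w n₋(1) w⁻¹ ∈ Γ`, the vectors `(0, 1) w⁻¹ γ`, `γ ∈ Γ`, form a locally finite set. -/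
lemma finite_bottomRow [DiscreteTopology Γ] {w : SL2R} (hw : w * stableMatrix 1 * w⁻¹ ∈ Γ)
    (C : ℝ) :
    {v : ℝ × ℝ | |v.1| ≤ C ∧ |v.2| ≤ C ∧ ∃ γ ∈ Γ, bottomRow (w⁻¹ * γ) = v}.Finite := by
  have hfin := finite_inter_of_isCompact (Γ := Γ) (isCompact_entries_le (1 + C ^ 2))
  have hsq : ∀ A : Set ℝ, A.Finite → {a : ℝ | a ^ 2 ∈ A}.Finite := by
    intro A hA
    refine ((hA.image Real.sqrt).union (hA.image fun a => -Real.sqrt a)).subset fun a ha => ?_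
    obtain h | h := le_total 0 a
    · exact Or.inl ⟨_, ha, Real.sqrt_sq h⟩
    · exact Or.inr ⟨_, ha, by simp [Real.sqrt_sq_eq_abs, abs_of_nonpos h]⟩
  -- The off-diagonal entries `-c ^ 2` and `d ^ 2` of the conjugate determine the row `(c, d)` up to
  -- signs.
  refine ((hsq _ (hfin.image fun g : SL2R => -g 1 0)).prod
    (hsq _ (hfin.image fun g : SL2R => g 0 1))).subset ?_
  rintro v ⟨h1, h2, γ, hγ, rfl⟩
  set M := w⁻¹ * γ
  have hc : |M 1 0| ≤ C := h1
  have hd : |M 1 1| ≤ C := h2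
  have hmem : M⁻¹ * stableMatrix 1 * M ∈ (Γ : Set SL2R) ∩ {g : SL2R | ∀ i j, |g i j| ≤ 1 + C ^ 2} := by
    constructor
    · have : M⁻¹ * stableMatrix 1 * M = γ⁻¹ * (w * stableMatrix 1 * w⁻¹) * γ := by
        simp only [M]; group
      rw [this]
      exact Γ.mul_mem (Γ.mul_mem (Γ.inv_mem hγ) hw) hγ
    · intro i j
      rw [conj_stableMatrix_one]
      have hcd : |M 1 0 * M 1 1| ≤ C ^ 2 := by
        rw [abs_mul, sq]; exact mul_le_mul hc hd (abs_nonneg _) ((abs_nonneg _).trans hc)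
      have hc2 : |M 1 0 ^ 2| ≤ C ^ 2 := by
        rw [abs_pow]; exact pow_le_pow_left₀ (abs_nonneg _) hc 2
      have hd2 : |M 1 1 ^ 2| ≤ C ^ 2 := by
        rw [abs_pow]; exact pow_le_pow_left₀ (abs_nonneg _) hd 2
      rw [abs_le] at *
      fin_cases i <;> fin_cases j <;> simp <;> constructor <;> linarith
  refine ⟨⟨_, hmem, ?_⟩, ⟨_, hmem, ?_⟩⟩
  · simp only [conj_stableMatrix_one]; simp [bottomRow]
  · simp only [conj_stableMatrix_one]; simp [bottomRow]

lemma bottomRow_mul (M g : SL2R) : bottomRow (M * g) =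
    ((bottomRow M).1 * g 0 0 + (bottomRow M).2 * g 1 0,
      (bottomRow M).1 * g 0 1 + (bottomRow M).2 * g 1 1) := by
  simp [bottomRow]

/-- Multiply the row of `M * g` by `g⁻¹`, whose entries are those of `g` up to order and sign. -/
lemma abs_bottomRow_le {M g : SL2R} {A B : ℝ} (hg : ∀ i j, |g i j| ≤ B)
    (hc : |(M * g) 1 0| ≤ A) (hd : |(M * g) 1 1| ≤ A) :
    |(bottomRow M).1| ≤ 2 * (A * B) ∧ |(bottomRow M).2| ≤ 2 * (A * B) := by
  have hdet := det_entry g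
  have h1 : (bottomRow M).1 = (M * g) 1 0 * g 1 1 - (M * g) 1 1 * g 1 0 := by
    simp only [bottomRow, mul_entry]; linear_combination -M 1 0 * hdet
  have h2 : (bottomRow M).2 = (M * g) 1 1 * g 0 0 - (M * g) 1 0 * g 0 1 := by
    simp only [bottomRow, mul_entry]; linear_combination -M 1 1 * hdet
  have hm : ∀ {a : ℝ} {i j}, |a| ≤ A → |a * g i j| ≤ A * B := fun {a i j} ha => by
    rw [abs_mul]; exact mul_le_mul ha (hg i j) (abs_nonneg _) ((abs_nonneg _).trans ha)
  rw [h1, h2]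
  exact ⟨(abs_sub _ _).trans (by linarith [hm hc (i := 1) (j := 1), hm hd (i := 1) (j := 0)]),
    (abs_sub _ _).trans (by linarith [hm hd (i := 0) (j := 0), hm hc (i := 0) (j := 1)])⟩

/-- The time `r` in the decomposition `n₋(s) a(t) n₊(-r)` of an element of `SL(2, ℝ)`. -/
def hitRatio (g : SL2R) : ℝ := g 1 0 / g 1 1

/-- Right multiplication by `g` preserves the determinant formed by the two bottom rows. Whether two
hits occur at the same time is therefore independent of `g`. -/
lemma hitRatio_eq_iff {M M' g : SL2R} (h : 0 < (M * g) 1 1) (h' : 0 < (M' * g) 1 1) :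
    hitRatio (M * g) = hitRatio (M' * g) ↔
      (bottomRow M).1 * (bottomRow M').2 = (bottomRow M').1 * (bottomRow M).2 := by
  rw [hitRatio, hitRatio, div_eq_div_iff h.ne' h'.ne', ← sub_eq_zero]
  conv_rhs => rw [← sub_eq_zero]
  have : (M * g) 1 0 * (M' * g) 1 1 - (M' * g) 1 0 * (M * g) 1 1 =
      (bottomRow M).1 * (bottomRow M').2 - (bottomRow M').1 * (bottomRow M).2 := by
    simp only [bottomRow, mul_entry]
    linear_combination (M 1 0 * M' 1 1 - M' 1 0 * M 1 1) * det_entry g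
  rw [this]

lemma eq_stableMatrix_mul_of_bottomRow_eq {M M' : SL2R} (h : bottomRow M = bottomRow M') :
    ∃ u, M' = stableMatrix u * M := by
  simp only [bottomRow, Prod.mk.injEq] at h
  obtain ⟨h00, h01, h10, h11⟩ := inv_entries M
  refine ⟨(M' * M⁻¹) 0 1, ?_⟩
  rw [← mul_inv_eq_iff_eq_mul]
  have d := det_entry M
  have d' := det_entry M'
  refine SL2R_ext ?_ rfl ?_ ?_ <;> simp only [mul_entry, h00, h01, h10, h11, stableMatrix_zero_zero,
    stableMatrix_one_zero, stableMatrix_one_one, h.1, h.2]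
  · linear_combination d'
  · ring
  · rw [h.1, h.2] at d; linear_combination d

end LatticeRows

/-! ### Hits as matrix decompositions. -/

section Hits

variable {Γ : Subgroup SL2R} {K : ℕ}

lemma sectionEmbed_eq_unstableFlow_iff {x : Fin K → UnitTangent Γ} {w : Fin K → SL2R}
    (hw : ∀ κ, proj Γ (w κ) = x κ) {R r : ℝ} {p : ℝ × ℝ × Fin K} {g : SL2R} :
    sectionEmbed x R p = unstableFlow r (proj Γ g) ↔ ∃ γ ∈ Γ, (w p.2.2)⁻¹ * γ * g =
      stableMatrix p.1 * geodesicMatrix (p.2.1 + R) * (unstableMatrix r)⁻¹ := by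
  rw [sectionEmbed, ← hw, stableFlow, geodesicFlow, unstableFlow, rightTranslate_proj,
    rightTranslate_proj, rightTranslate_proj, eq_comm, eq_comm, proj_eq_proj]
  refine exists_congr fun γ => and_congr_right fun _ => ?_
  rw [eq_mul_inv_iff_mul_eq]
  simp only [mul_assoc]
  rw [inv_mul_eq_iff_eq_mul]

lemma mem_multiSection_iff {x : Fin K → UnitTangent Γ} {σ : Fin K → ℝ} {R : ℝ}
    {y : UnitTangent Γ} :
    y ∈ multiSection x σ R ↔
      ∃ p : ℝ × ℝ × Fin K, σ p.2.2 ≤ p.2.1 ∧ sectionEmbed x R p = y := by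
  constructor
  · intro h
    obtain ⟨κ, t, ht, _, ⟨s, rfl⟩, h⟩ := mem_iUnion.1 h
    exact ⟨(s, t - R, κ), le_sub_iff_add_le.2 ht, by simpa [sectionEmbed] using h⟩
  · rintro ⟨p, hp, rfl⟩
    exact mem_iUnion.2 ⟨p.2.2, p.2.1 + R, add_le_add_left hp R, _, ⟨p.1, rfl⟩, rfl⟩

lemma decomposition_entries (s t r : ℝ) :
    (stableMatrix s * geodesicMatrix t * (unstableMatrix r)⁻¹) 0 1 = s * Real.exp (-t / 2) ∧
    (stableMatrix s * geodesicMatrix t * (unstableMatrix r)⁻¹) 1 0 = r * Real.exp (-t / 2) ∧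
    (stableMatrix s * geodesicMatrix t * (unstableMatrix r)⁻¹) 1 1 = Real.exp (-t / 2) := by
  obtain ⟨h00, h01, h10, h11⟩ := inv_entries (unstableMatrix r)
  rw [mul_entry _ (unstableMatrix r)⁻¹, mul_entry _ (unstableMatrix r)⁻¹,
    mul_entry _ (unstableMatrix r)⁻¹, h00, h01, h10, h11]
  simp [mul_comm]

/-- Three matching entries suffice: since `g 1 1 ≠ 0`, the determinant fixes the fourth. -/
lemma eq_decomposition {g : SL2R} (hg : 0 < g 1 1) :
    g = stableMatrix (sectionCoord g).1 * geodesicMatrix (sectionCoord g).2 *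
      (unstableMatrix (hitRatio g))⁻¹ := by
  obtain ⟨h01, h10, h11⟩ :=
    decomposition_entries (sectionCoord g).1 (sectionCoord g).2 (hitRatio g)
  have he : Real.exp (-(sectionCoord g).2 / 2) = g 1 1 := by
    rw [sectionCoord, ← Real.exp_log hg]; simp
  rw [he] at h01 h10 h11
  have e01 : (sectionCoord g).1 * g 1 1 = g 0 1 := div_mul_cancel₀ _ hg.ne'
  have e10 : hitRatio g * g 1 1 = g 1 0 := div_mul_cancel₀ _ hg.ne'
  rw [e01] at h01
  rw [e10] at h10
  set h := stableMatrix (sectionCoord g).1 * geodesicMatrix (sectionCoord g).2 *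
      (unstableMatrix (hitRatio g))⁻¹
  refine SL2R_ext ?_ h01.symm h10.symm h11.symm
  have d := det_entry g
  have d' := det_entry h
  rw [h01, h10, h11] at d'
  exact mul_right_cancel₀ hg.ne' (by linear_combination d - d')

variable [DiscreteTopology Γ] {x : Fin K → UnitTangent Γ} {w : Fin K → SL2R}

/-- The set of hits is locally finite. -/
lemma finite_hitTimes (hw : ∀ κ, proj Γ (w κ) = x κ)
    (hper : ∀ κ, w κ * stableMatrix 1 * (w κ)⁻¹ ∈ Γ) (σ : Fin K → ℝ) (R : ℝ) (y : UnitTangent Γ)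
    (B : ℝ) : (hitTimes x σ R y ∩ Icc 0 B).Finite := by
  obtain ⟨g, rfl⟩ := proj_surjective y
  obtain ⟨G, hG⟩ : ∃ G, ∀ i j, |g i j| ≤ G :=
    ⟨∑ i, ∑ j, |g i j|, fun i j =>
      (Finset.single_le_sum (f := fun j => |g i j|) (fun _ _ => abs_nonneg _)
        (Finset.mem_univ j)).trans (Finset.single_le_sum (f := fun i => ∑ j, |g i j|)
          (fun _ _ => Finset.sum_nonneg fun _ _ => abs_nonneg _) (Finset.mem_univ i))⟩
  -- A hit at time `r` has bottom row `exp (-(t + R) / 2) * (r, 1)` with `t ≥ σ κ` and `r ≤ B`;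
  -- undoing `g` gives this bound. The row of `(w κ)⁻¹ γ` determines `r`.
  refine (Set.finite_iUnion fun κ => (finite_bottomRow (hper κ)
    (2 * ((1 + |B|) * Real.exp (-(σ κ + R) / 2) * G))).image fun v =>
      (v.1 * g 0 0 + v.2 * g 1 0) / (v.1 * g 0 1 + v.2 * g 1 1)).subset ?_
  rintro r ⟨hr, hr0, hrB⟩
  obtain ⟨p, hp, he⟩ := mem_multiSection_iff.1 hr
  obtain ⟨γ, hγ, hm⟩ := (sectionEmbed_eq_unstableFlow_iff hw).1 he
  obtain ⟨-, h10, h11⟩ := decomposition_entries p.1 (p.2.1 + R) r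
  rw [← hm] at h10 h11
  have hexp : Real.exp (-(p.2.1 + R) / 2) ≤ Real.exp (-(σ p.2.2 + R) / 2) :=
    Real.exp_le_exp.2 (by linarith)
  have hB : r ≤ |B| := hrB.trans (le_abs_self B)
  have hpos := Real.exp_pos (-(p.2.1 + R) / 2)
  obtain ⟨h1, h2⟩ := abs_bottomRow_le (M := (w p.2.2)⁻¹ * γ) (g := g)
    (A := (1 + |B|) * Real.exp (-(σ p.2.2 + R) / 2)) hG
    (by rw [h10, abs_of_nonneg (by positivity)]
        exact mul_le_mul (by linarith) hexp hpos.le (by positivity))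
    (by rw [h11, abs_of_pos hpos]
        nlinarith [abs_nonneg B])
  refine mem_iUnion.2 ⟨p.2.2, _, ⟨h1, h2, γ, hγ, rfl⟩, ?_⟩
  have hrow := bottomRow_mul ((w p.2.2)⁻¹ * γ) g
  rw [bottomRow, h10, h11, Prod.mk.injEq] at hrow
  dsimp only
  rw [← hrow.1, ← hrow.2, mul_div_cancel_right₀ _ hpos.ne']

/-- The group element `m` describes a hit up to time `T` with parameters in `D`. -/
def IsHit (T : ℝ) (D : Set (ℝ × ℝ × Fin K)) (κ : Fin K) (m : SL2R) : Prop :=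
  0 < m 1 1 ∧ 0 < hitRatio m ∧ hitRatio m ≤ T ∧
    (Int.fract (sectionCoord m).1, (sectionCoord m).2, κ) ∈ D


end Hits

/-! ### Hits modulo the stabiliser of the horocycle. -/

section HitCoordinates

variable {Γ : Subgroup SL2R} {K : ℕ} {x : Fin K → UnitTangent Γ} {w : Fin K → SL2R}
  (hper : ∀ κ (s : ℝ), w κ * stableMatrix s * (w κ)⁻¹ ∈ Γ ↔ ∃ m : ℤ, s = m)

include hper in
-- Equal bottom rows differ by some `n₋(u)`, and membership in `Γ` forces `u` to be an integer. This
-- only shifts the `s`-coordinate by an integer, which `Int.fract` ignores.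
lemma isHit_congr {T : ℝ} {D : Set (ℝ × ℝ × Fin K)} {κ : Fin K} {γ γ' : SL2R} (hγ : γ ∈ Γ)
    (hγ' : γ' ∈ Γ) (h : bottomRow ((w κ)⁻¹ * γ) = bottomRow ((w κ)⁻¹ * γ')) (g : SL2R) :
    (IsHit T D κ ((w κ)⁻¹ * γ * g) ↔ IsHit T D κ ((w κ)⁻¹ * γ' * g)) ∧
      hitRatio ((w κ)⁻¹ * γ * g) = hitRatio ((w κ)⁻¹ * γ' * g) := by
  obtain ⟨u, hu⟩ := eq_stableMatrix_mul_of_bottomRow_eq h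
  obtain ⟨m, rfl⟩ := (hper κ u).1 <| by
    have : w κ * stableMatrix u * (w κ)⁻¹ = γ' * γ⁻¹ := by
      rw [← mul_inv_eq_iff_eq_mul] at hu
      rw [← hu]
      group
    rw [this]
    exact Γ.mul_mem hγ' (Γ.inv_mem hγ)
  rw [hu, mul_assoc (stableMatrix _)]
  generalize (w κ)⁻¹ * γ * g = M
  have h10 : (stableMatrix m * M) 1 0 = M 1 0 := by simp
  have h11 : (stableMatrix m * M) 1 1 = M 1 1 := by simp
  have h01 : (stableMatrix m * M) 0 1 = M 0 1 + m * M 1 1 := by simp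
  have hr : hitRatio M = hitRatio (stableMatrix m * M) := by rw [hitRatio, hitRatio, h10, h11]
  refine ⟨?_, hr⟩
  rw [IsHit, IsHit, ← hr, h11]
  refine and_congr_right fun hpos => ?_
  rw [sectionCoord, sectionCoord, h01, h11, add_div, mul_div_cancel_right₀ _ hpos.ne',
    Int.fract_add_intCast]

include hper in
lemma hitTimesIn_eq (hw : ∀ κ, proj Γ (w κ) = x κ) {σ : Fin K → ℝ} {D : Set (ℝ × ℝ × Fin K)}
    (hD : D ⊆ sectionParam σ) (T : ℝ) (g : SL2R) :
    hitTimesIn x σ 0 T D (proj Γ g) = {r | ∃ κ, ∃ γ ∈ Γ, IsHit T D κ ((w κ)⁻¹ * γ * g) ∧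
      hitRatio ((w κ)⁻¹ * γ * g) = r} := by
  ext r
  constructor
  · rintro ⟨h0, hT, p, hpD, hp, he⟩
    obtain ⟨γ, hγ, hm⟩ := (sectionEmbed_eq_unstableFlow_iff hw).1 he
    obtain ⟨h01, h10, h11⟩ := decomposition_entries p.1 (p.2.1 + 0) r
    have hpos := Real.exp_pos (-(p.2.1 + 0) / 2)
    rw [← hm] at h01 h10 h11
    have hr : hitRatio ((w p.2.2)⁻¹ * γ * g) = r := by
      rw [hitRatio, h10, h11, mul_div_cancel_right₀ _ hpos.ne']
    refine ⟨p.2.2, γ, hγ, ⟨h11 ▸ hpos, hr ▸ h0, ?_, ?_⟩, hr⟩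
    · rw [hr]; simpa using hT
    · rw [sectionCoord, h01, h11, mul_div_cancel_right₀ _ hpos.ne', Real.log_exp,
        Int.fract_eq_self.2 hp.1]
      convert hpD
      ring_nf
  · rintro ⟨κ, γ, hγ, ⟨hpos, h0, hT, hmem⟩, rfl⟩
    refine ⟨h0, by simpa using hT, _, hmem, hD hmem, ?_⟩
    rw [sectionEmbed_eq_unstableFlow_iff hw]
    set m := (w κ)⁻¹ * γ * g with hm
    set f := ⌊(sectionCoord m).1⌋
    -- Replacing `γ` by another element of `Γ` brings the `s`-coordinate into `[0, 1)`.
    refine ⟨w κ * stableMatrix (-f : ℤ) * (w κ)⁻¹ * γ,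
      Γ.mul_mem ((hper κ _).2 ⟨_, rfl⟩) hγ, ?_⟩
    have h1 : (w κ)⁻¹ * (w κ * stableMatrix (-f : ℤ) * (w κ)⁻¹ * γ) * g =
        stableMatrix (-f : ℤ) * m := by
      rw [hm]; group
    have h2 : stableMatrix (-f : ℤ) * stableMatrix (sectionCoord m).1 =
        stableMatrix (Int.fract (sectionCoord m).1) := by
      refine SL2R_ext ?_ ?_ ?_ ?_ <;> simp [f]
      linarith [Int.fract_add_floor (sectionCoord m).1]
    dsimp only
    rw [h1, add_zero, ← h2]
    conv_lhs => rw [eq_decomposition hpos]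
    simp only [mul_assoc]

end HitCoordinates

/-! ### Local constancy of the counts. -/

section LocalConstancy

lemma eventually_lt_iff {X : Type*} [TopologicalSpace X] {f : X → ℝ} {a : X} {b : ℝ}
    (hf : ContinuousAt f a) (h : f a ≠ b) : ∀ᶠ y in 𝓝 a, b < f y ↔ b < f a := by
  obtain h | h := lt_or_gt_of_ne h
  · filter_upwards [hf.eventually_lt_const h] with y hy
    exact iff_of_false hy.not_gt h.not_gt
  · filter_upwards [hf.eventually_const_lt h] with y hy
    exact iff_of_true hy h

lemma eventually_mem_iff {X : Type*} [TopologicalSpace X] {s : Set X} {a : X}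
    (h : a ∉ frontier s) : ∀ᶠ y in 𝓝 a, y ∈ s ↔ a ∈ s := by
  by_cases ha : a ∈ s
  · have : a ∈ interior s := by
      by_contra h'
      exact h ((mem_frontier_iff_notMem_interior ha).2 h')
    filter_upwards [mem_interior_iff_mem_nhds.1 this] with y hy
    exact iff_of_true hy ha
  · have : sᶜ ∈ 𝓝 a := by
      refine mem_interior_iff_mem_nhds.1 ?_
      rw [interior_compl]
      exact fun h' => h ⟨h', fun h'' => ha (interior_subset h'')⟩
    filter_upwards [this] with y hy
    exact iff_of_false hy ha

/-- The exceptional set of coordinates for the sheet with label `κ`. -/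
def exceptionalCoords {K : ℕ} (D : Set (ℝ × ℝ × Fin K)) (κ : Fin K) : Set (ℝ × ℝ) :=
  {q | (∃ n : ℤ, q.1 = n) ∨ (Int.fract q.1, q.2, κ) ∈ frontier D}

/-- The exceptional set of group elements, outside which `IsHit` is locally constant. -/
def exceptionalSet {K : ℕ} (T : ℝ) (D : Set (ℝ × ℝ × Fin K)) (κ : Fin K) : Set SL2R :=
  {m | m 1 1 = 0 ∨ m 1 0 = 0 ∨ m 1 0 = T * m 1 1 ∨
    (0 < m 1 1 ∧ sectionCoord m ∈ exceptionalCoords D κ)}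

lemma continuousAt_hitRatio {m : SL2R} (hm : m 1 1 ≠ 0) : ContinuousAt hitRatio m :=
  (continuous_entry 1 0).continuousAt.div (continuous_entry 1 1).continuousAt hm

lemma continuousAt_sectionCoord {m : SL2R} (hm : m 1 1 ≠ 0) : ContinuousAt sectionCoord m :=
  ((continuous_entry 0 1).continuousAt.div (continuous_entry 1 1).continuousAt hm).prodMk
    (((continuous_entry 1 1).continuousAt.log hm).const_mul (-2))

lemma eventually_isHit_iff {K : ℕ} {T : ℝ} {D : Set (ℝ × ℝ × Fin K)} {κ : Fin K} {m : SL2R}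
    (hm : m ∉ exceptionalSet T D κ) : ∀ᶠ m' in 𝓝 m, IsHit T D κ m' ↔ IsHit T D κ m := by
  simp only [exceptionalSet, mem_ofPred_eq, not_or, not_and] at hm
  obtain ⟨h11, h10, hT, hcoord⟩ := hm
  have ev := eventually_lt_iff (continuous_entry 1 1).continuousAt h11
  by_cases hpos : 0 < m 1 1
  · have hE := hcoord hpos
    simp only [exceptionalCoords, mem_ofPred_eq, not_or] at hE
    obtain ⟨hint, hfr⟩ := hE
    have hc := continuousAt_sectionCoord h11
    have e1 := eventually_lt_iff (continuousAt_hitRatio h11) (b := 0) (div_ne_zero h10 h11)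
    have e2 := eventually_lt_iff (continuousAt_hitRatio h11) (b := T)
      (fun h => hT ((div_eq_iff h11).1 h))
    have hp : ContinuousAt (fun m : SL2R => (Int.fract (sectionCoord m).1, (sectionCoord m).2, κ))
        m := by
      refine ContinuousAt.prodMk ?_ (hc.snd.prodMk continuousAt_const)
      -- `Int.fract` jumps at integers, which is why they belong to `exceptionalCoords`.
      exact ContinuousAt.comp (g := Int.fract) (continuousAt_fract fun h => hint ⟨_, h⟩) hc.fst
    have e3 := hp.eventually (eventually_mem_iff hfr)
    filter_upwards [ev, e1, e2, e3] with m' a0 a1 a2 a3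
    rw [IsHit, IsHit, a0, a1, ← not_lt, a2, not_lt, a3]
  · filter_upwards [ev] with m' a0
    exact iff_of_false (fun h => hpos (a0.1 h.1)) (fun h => hpos h.1)

/-- The number of distinct values depends only on which values coincide. -/
lemma encard_image_eq_of_forall {α β : Type*} {s : Set α} {f f' : α → β}
    (h : ∀ a ∈ s, ∀ b ∈ s, f a = f b ↔ f' a = f' b) : (f '' s).encard = (f' '' s).encard := by
  obtain ⟨t, hts, ht⟩ := exists_subset_bijOn s f
  have hinj : InjOn f' t := fun a ha b hb hab => ht.injOn ha hb ((h a (hts ha) b (hts hb)).2 hab)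
  have him : f' '' s = f' '' t := by
    refine (image_subset_iff.2 fun a ha => ?_).antisymm (image_mono hts)
    obtain ⟨b, hb, hab⟩ := ht.surjOn ⟨a, ha, rfl⟩
    exact ⟨b, hb, (h b (hts hb) a ha).1 hab⟩
  rw [him, hinj.encard_image, ← ht.image_eq, ht.injOn.encard_image]

variable {Γ : Subgroup SL2R} {K : ℕ} {x : Fin K → UnitTangent Γ} {w : Fin K → SL2R}
  (hper : ∀ κ (s : ℝ), w κ * stableMatrix s * (w κ)⁻¹ ∈ Γ ↔ ∃ m : ℤ, s = m)

/-- Finitely many elements of `Γ` account for all hits near a given point. -/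
lemma exists_finite_representatives [DiscreteTopology Γ] {w : SL2R}
    (hw : w * stableMatrix 1 * w⁻¹ ∈ Γ) (C : ℝ) :
    ∃ I : Set SL2R, I.Finite ∧ I ⊆ Γ ∧ ∀ γ ∈ Γ, |(bottomRow (w⁻¹ * γ)).1| ≤ C →
      |(bottomRow (w⁻¹ * γ)).2| ≤ C →
      ∃ γ' ∈ I, bottomRow (w⁻¹ * γ) = bottomRow (w⁻¹ * γ') := by
  obtain ⟨I, hI, hbij⟩ := exists_subset_bijOn
    {γ | γ ∈ Γ ∧ |(bottomRow (w⁻¹ * γ)).1| ≤ C ∧ |(bottomRow (w⁻¹ * γ)).2| ≤ C}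
    (fun γ => bottomRow (w⁻¹ * γ))
  refine ⟨I, hbij.finite_iff_finite.2 ((finite_bottomRow hw C).subset ?_),
    fun γ hγ => (hI hγ).1, fun γ hγ h1 h2 => ?_⟩
  · rintro _ ⟨γ, ⟨h1, h2, h3⟩, rfl⟩
    exact ⟨h2, h3, γ, h1, rfl⟩
  · obtain ⟨γ', h, h'⟩ := hbij.surjOn ⟨γ, ⟨hγ, h1, h2⟩, rfl⟩
    exact ⟨γ', h, h'.symm⟩

include hper in
-- Near `g` all hits come from one finite list of elements of `Γ`, and each `IsHit` condition is
-- locally constant there. The hit times move with `g'`, but their coincidences do not.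
lemma eventually_encard_hitTimesIn_eq [DiscreteTopology Γ] (hw : ∀ κ, proj Γ (w κ) = x κ)
    {σ : Fin K → ℝ} {D : Set (ℝ × ℝ × Fin K)} (hD : D ⊆ sectionParam σ) {T : ℝ} {g : SL2R}
    (hg : ∀ κ, ∀ γ ∈ Γ, (w κ)⁻¹ * γ * g ∉ exceptionalSet T D κ) :
    ∀ᶠ g' in 𝓝 g, (hitTimesIn x σ 0 T D (proj Γ g')).encard =
      (hitTimesIn x σ 0 T D (proj Γ g)).encard := by
  obtain ⟨B, hB⟩ : ∃ B, ∀ᶠ g' : SL2R in 𝓝 g, ∀ i j, |g' i j| ≤ B := by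
    have hc : Continuous fun g' : SL2R => ∑ i, ∑ j, |g' i j| := by fun_prop
    refine ⟨1 + ∑ i, ∑ j, |g i j|, ?_⟩
    filter_upwards [hc.continuousAt.eventually_le_const (lt_one_add _)] with g' hg' i j
    exact ((Finset.single_le_sum (f := fun j => |g' i j|) (fun _ _ => abs_nonneg _)
        (Finset.mem_univ j)).trans (Finset.single_le_sum (f := fun i => ∑ j, |g' i j|)
          (fun _ _ => Finset.sum_nonneg fun _ _ => abs_nonneg _) (Finset.mem_univ i))).trans hg'
  -- For a hit `m`, `m 1 1 ≤ exp (-σ κ / 2)` by the height constraint and `m 1 0 = hitRatio m * m 1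
  -- 1` with `hitRatio m ≤ T`.
  choose I hIfin hIΓ hI using fun κ => exists_finite_representatives (Γ := Γ) (w := w κ)
    ((hper κ 1).2 ⟨1, by simp⟩) (2 * ((1 + |T|) * Real.exp (-σ κ / 2) * B))
  have hJfin : {q : Fin K × SL2R | q.2 ∈ I q.1}.Finite := by
    refine (Set.finite_iUnion fun κ => (hIfin κ).image (Prod.mk κ)).subset ?_
    exact fun q hq => mem_iUnion.2 ⟨q.1, q.2, hq, rfl⟩
  have hrep : ∀ g' : SL2R, (∀ i j, |g' i j| ≤ B) → hitTimesIn x σ 0 T D (proj Γ g') =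
      (fun q : Fin K × SL2R => hitRatio ((w q.1)⁻¹ * q.2 * g')) ''
        {q | q.2 ∈ I q.1 ∧ IsHit T D q.1 ((w q.1)⁻¹ * q.2 * g')} := by
    intro g' hg'
    rw [hitTimesIn_eq hper hw hD]
    ext r
    constructor
    · rintro ⟨κ, γ, hγ, hhit, rfl⟩
      obtain ⟨hpos, h0, hT, hmem⟩ := hhit
      have ht : σ κ ≤ (sectionCoord ((w κ)⁻¹ * γ * g')).2 := (hD hmem).2
      set m := (w κ)⁻¹ * γ * g' with hm
      have h11 : m 1 1 ≤ Real.exp (-σ κ / 2) := by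
        rw [← Real.log_le_iff_le_exp hpos]
        simp only [sectionCoord] at ht
        linarith
      have hT' : hitRatio m ≤ 1 + |T| := by linarith [le_abs_self T]
      have e10 : hitRatio m * m 1 1 = m 1 0 := div_mul_cancel₀ _ hpos.ne'
      have hexp := Real.exp_pos (-σ κ / 2)
      obtain ⟨h1, h2⟩ := abs_bottomRow_le (M := (w κ)⁻¹ * γ) (g := g')
        (A := (1 + |T|) * Real.exp (-σ κ / 2)) hg'
        (by rw [← hm, ← e10, abs_of_pos (mul_pos h0 hpos)]
            exact mul_le_mul hT' h11 hpos.le (by positivity))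
        (by rw [← hm, abs_of_pos hpos]
            nlinarith [abs_nonneg T])
      obtain ⟨γ', hγ', hrow⟩ := hI κ γ hγ h1 h2
      obtain ⟨c1, c2⟩ := isHit_congr hper (T := T) (D := D) hγ (hIΓ κ hγ') hrow g'
      exact ⟨(κ, γ'), ⟨hγ', c1.1 ⟨hpos, h0, hT, hmem⟩⟩, c2.symm⟩
    · rintro ⟨⟨κ, γ⟩, ⟨h1, h2⟩, rfl⟩
      exact ⟨κ, γ, hIΓ κ h1, h2, rfl⟩
  have hev : ∀ᶠ g' in 𝓝 g, ∀ q ∈ {q : Fin K × SL2R | q.2 ∈ I q.1},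
      (IsHit T D q.1 ((w q.1)⁻¹ * q.2 * g') ↔ IsHit T D q.1 ((w q.1)⁻¹ * q.2 * g)) := by
    rw [Filter.eventually_all_finite hJfin]
    intro q hq
    exact (continuous_const_mul ((w q.1)⁻¹ * q.2)).continuousAt.eventually
      (eventually_isHit_iff (hg q.1 q.2 (hIΓ _ hq)))
  filter_upwards [hB, hev] with g' hg' hiff
  have hset : {q : Fin K × SL2R | q.2 ∈ I q.1 ∧ IsHit T D q.1 ((w q.1)⁻¹ * q.2 * g')} =
      {q | q.2 ∈ I q.1 ∧ IsHit T D q.1 ((w q.1)⁻¹ * q.2 * g)} := by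
    ext q
    exact and_congr_right (hiff q)
  rw [hrep g' hg', hrep g hB.self_of_nhds, hset]
  refine encard_image_eq_of_forall fun a ha b hb => ?_
  rw [hitRatio_eq_iff ((hiff a ha.1).2 ha.2).1 ((hiff b hb.1).2 hb.2).1,
    hitRatio_eq_iff ha.2.1 hb.2.1]

end LocalConstancy

/-! ### The exceptional set is Haar-null. -/

section ExceptionalSetNull

variable {K : ℕ} {D : Set (ℝ × ℝ × Fin K)}

/-- Fubini; counting measure on `Fin K` charges every sheet. -/
lemma volume_slice_eq_zero {S : Set (ℝ × ℝ × Fin K)} (hSm : MeasurableSet S)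
    (hS : sheetVolume K S = 0) (κ : Fin K) : volume {q : ℝ × ℝ | (q.1, q.2, κ) ∈ S} = 0 := by
  have hm : MeasurableSet {q : ℝ × ℝ | (q.1, q.2, κ) ∈ S} :=
    (by fun_prop : Measurable fun q : ℝ × ℝ => (q.1, q.2, κ)) hSm
  rw [Measure.volume_eq_prod, Measure.measure_prod_null hm]
  filter_upwards [Measure.measure_ae_null_of_prod_null hS] with s hs
  rw [Pi.zero_apply, measure_eq_zero_iff_ae_notMem]
  filter_upwards [Measure.measure_ae_null_of_prod_null hs] with t ht hmem
  rw [Pi.zero_apply, Measure.count_eq_zero_iff] at ht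
  exact (ht ▸ (show κ ∈ Prod.mk t ⁻¹' (Prod.mk s ⁻¹' S) from hmem) : κ ∈ (∅ : Set (Fin K)))

/-- The set lies in countably many vertical lines and integer translates of a null slice. -/
lemma volume_exceptionalCoords_eq_zero (hD : sheetVolume K (frontier D) = 0) (κ : Fin K) :
    volume (exceptionalCoords D κ) = 0 := by
  have hA := volume_slice_eq_zero isClosed_frontier.measurableSet hD κ
  set A := {q : ℝ × ℝ | (q.1, q.2, κ) ∈ frontier D}
  refine measure_mono_null (t := (⋃ n : ℤ, ({(n : ℝ)} ×ˢ univ : Set (ℝ × ℝ))) ∪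
    ⋃ n : ℤ, (fun q : ℝ × ℝ => q + (-(n : ℝ), 0)) ⁻¹' A) ?_ ?_
  · rintro q (⟨n, hn⟩ | hq)
    · exact Or.inl (mem_iUnion.2 ⟨n, hn, trivial⟩)
    · refine Or.inr (mem_iUnion.2 ⟨⌊q.1⌋, ?_⟩)
      simpa [A, ← sub_eq_add_neg, Int.self_sub_floor] using hq
  · refine measure_union_null (measure_iUnion_null fun n => ?_) (measure_iUnion_null fun n => ?_)
    · rw [Measure.volume_eq_prod, Measure.prod_prod, Real.volume_singleton, zero_mul]
    · rwa [measure_preimage_add_right]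

lemma measure_exceptionalSet_eq_zero (ν : Measure SL2R) [ν.IsHaarMeasure]
    (hD : sheetVolume K (frontier D) = 0) (T : ℝ) (κ : Fin K) : ν (exceptionalSet T D κ) = 0 := by
  have h1 : ν {m | m 1 1 = 0} = 0 := by
    simpa using measure_row_one_eq_zero ν (z := (0, 1)) (by simp)
  have h2 : ν {m | m 1 0 = 0} = 0 := by
    simpa using measure_row_one_eq_zero ν (z := (1, 0)) (by simp)
  have h3 : ν {m | m 1 0 = T * m 1 1} = 0 := by
    refine measure_mono_null (fun m hm => ?_)
      (measure_row_one_eq_zero ν (z := (1, -T)) (by simp))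
    simp only [mem_ofPred_eq] at hm ⊢
    linear_combination hm
  exact measure_union_null h1 (measure_union_null h2 (measure_union_null h3
    (measure_sectionCoord_mem_eq_zero ν (volume_exceptionalCoords_eq_zero hD κ))))

end ExceptionalSetNull

/-! ### Renormalisation and the limit. -/

section Limit

variable {Γ : Subgroup SL2R}

lemma isOpenMap_proj : IsOpenMap (proj Γ) := isOpenMap_quotient_mk'_mul

lemma continuous_proj : Continuous (proj Γ) := continuous_quotient_mk'

/-- The projection is open, so local constancy upstairs descends to the quotient. -/
lemma proj_notMem_frontier {E : Set (UnitTangent Γ)} {g : SL2R}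
    (h : ∀ᶠ g' in 𝓝 g, proj Γ g' ∈ E ↔ proj Γ g ∈ E) : proj Γ g ∉ frontier E := by
  have h' : ∀ᶠ y in 𝓝 (proj Γ g), y ∈ E ↔ proj Γ g ∈ E :=
    isOpenMap_proj.nhds_le g (eventually_map.2 h)
  by_cases hg : proj Γ g ∈ E
  · refine fun hf => (mem_frontier_iff_notMem_interior hg).1 hf (mem_interior_iff_mem_nhds.2 ?_)
    filter_upwards [h'] with y hy using hy.2 hg
  · rw [← frontier_compl]
    refine fun hf => (mem_frontier_iff_notMem_interior (s := Eᶜ) hg).1 hf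
      (mem_interior_iff_mem_nhds.2 ?_)
    filter_upwards [h'] with y hy using fun hyE => hg (hy.1 hyE)

lemma geodesicMatrix_mul (s t : ℝ) :
    geodesicMatrix s * geodesicMatrix t = geodesicMatrix (s + t) := by
  refine SL2R_ext ?_ ?_ ?_ ?_ <;> simp [← Real.exp_add] <;> ring

lemma geodesicFlow_geodesicFlow (s t : ℝ) (y : UnitTangent Γ) :
    geodesicFlow s (geodesicFlow t y) = geodesicFlow (t + s) y := by
  obtain ⟨g, rfl⟩ := proj_surjective y
  simp only [geodesicFlow, rightTranslate_proj, mul_assoc, geodesicMatrix_mul]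

lemma geodesicFlow_zero (y : UnitTangent Γ) : geodesicFlow 0 y = y := by
  obtain ⟨g, rfl⟩ := proj_surjective y
  rw [geodesicFlow, rightTranslate_proj]
  congr 1
  rw [mul_eq_left]
  refine SL2R_ext ?_ ?_ ?_ ?_ <;> simp

lemma geodesicFlow_injective (t : ℝ) :
    Function.Injective (geodesicFlow t : UnitTangent Γ → UnitTangent Γ) :=
  Function.LeftInverse.injective (g := geodesicFlow (-t)) fun y => by
    rw [geodesicFlow_geodesicFlow, add_neg_cancel, geodesicFlow_zero]

/-- This commutation relation is the source of the time scaling `exp (-R)`. -/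
lemma unstableFlow_geodesicFlow (R r : ℝ) (y : UnitTangent Γ) :
    unstableFlow r (geodesicFlow R y) = geodesicFlow R (unstableFlow (Real.exp (-R) * r) y) := by
  obtain ⟨g, rfl⟩ := proj_surjective y
  simp only [geodesicFlow, unstableFlow, rightTranslate_proj, mul_assoc]
  congr 2
  have h : Real.exp (-R / 2) = Real.exp (-R) * Real.exp (R / 2) := by
    rw [← Real.exp_add]; ring_nf
  refine SL2R_ext ?_ ?_ ?_ ?_ <;> simp [h]
  ring

variable {K : ℕ} {x : Fin K → UnitTangent Γ} {w : Fin K → SL2R}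

lemma sectionEmbed_eq_geodesicFlow (R : ℝ) (p : ℝ × ℝ × Fin K) :
    sectionEmbed x R p = geodesicFlow R (sectionEmbed x 0 p) := by
  rw [sectionEmbed, sectionEmbed, geodesicFlow_geodesicFlow, add_zero]

lemma mem_hitTimesIn_geodesicFlow_iff {σ : Fin K → ℝ} {R T : ℝ} {D : Set (ℝ × ℝ × Fin K)}
    {y : UnitTangent Γ} {r : ℝ} :
    r ∈ hitTimesIn x σ R T D (geodesicFlow R y) ↔ Real.exp (-R) * r ∈ hitTimesIn x σ 0 T D y := by
  simp only [hitTimesIn, mem_ofPred_eq, unstableFlow_geodesicFlow, sectionEmbed_eq_geodesicFlow R,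
    (geodesicFlow_injective R).eq_iff, mul_pos_iff_of_pos_left (Real.exp_pos (-R)), neg_zero,
    Real.exp_zero, one_mul]

lemma hitCount_geodesicFlow [DiscreteTopology Γ] (hw : ∀ κ, proj Γ (w κ) = x κ)
    (hper : ∀ κ, w κ * stableMatrix 1 * (w κ)⁻¹ ∈ Γ) (σ : Fin K → ℝ) (R T : ℝ)
    (D : Set (ℝ × ℝ × Fin K)) (y : UnitTangent Γ) :
    hitCount x σ R T D (geodesicFlow R y) = hitCount x σ 0 T D y := by
  rw [hitCount_eq_encard (finite_hitTimes hw hper σ R _),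
    hitCount_eq_encard (finite_hitTimes hw hper σ 0 _)]
  have hinj : Function.Injective fun r : ℝ => Real.exp (-R) * r :=
    mul_right_injective₀ (Real.exp_ne_zero _)
  rw [← hinj.encard_image]
  congr 1
  ext r
  constructor
  · rintro ⟨r, hr, rfl⟩
    exact mem_hitTimesIn_geodesicFlow_iff.1 hr
  · intro hr
    have h : Real.exp (-R) * (Real.exp R * r) = r := by
      rw [← mul_assoc, ← Real.exp_add]; simp
    exact ⟨Real.exp R * r, mem_hitTimesIn_geodesicFlow_iff.2 (by rwa [h]), h⟩

/-- Admissibility speaks only of Borel sets. The interior and closure of `E` are Borel, have the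
same `μ`-measure as `E` and null boundaries, and squeeze `E`; measurability of the event need not be
checked. -/
lemma Admissible.tendsto_of_measure_frontier_eq_zero {μ lam : Measure (UnitTangent Γ)}
    (h : Admissible μ lam) {E : Set (UnitTangent Γ)} (hE : μ (frontier E) = 0) :
    Tendsto (fun t : ℝ => lam (geodesicFlow t '' E)) atTop (𝓝 (μ E)) := by
  have hint : μ (interior E) = μ E := measure_congr (interior_ae_eq_of_null_frontier hE)
  have hcl : μ (closure E) = μ E := measure_congr (closure_ae_eq_of_null_frontier hE)
  have h1 := h _ isOpen_interior.measurableSet (measure_mono_null frontier_interior_subset hE)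
  have h2 := h _ isClosed_closure.measurableSet (measure_mono_null frontier_closure_subset hE)
  rw [hint] at h1
  rw [hcl] at h2
  exact tendsto_of_tendsto_of_tendsto_of_le_of_le h1 h2
    (fun t => measure_mono (image_mono interior_subset))
    (fun t => measure_mono (image_mono subset_closure))

lemma measure_frontier_hitCount_eq_zero [DiscreteTopology Γ] (hw : ∀ κ, proj Γ (w κ) = x κ)
    (hper : ∀ κ (s : ℝ), w κ * stableMatrix s * (w κ)⁻¹ ∈ Γ ↔ ∃ m : ℤ, s = m)
    {μ : Measure (UnitTangent Γ)} (hμ : IsLiouville Γ μ) {ι : Type*} [Finite ι] (σ : Fin K → ℝ)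
    (k : ι → ℕ) (T : ι → ℝ) {D : ι → Set (ℝ × ℝ × Fin K)} (hDsub : ∀ i, D i ⊆ sectionParam σ)
    (hDbdry : ∀ i, sheetVolume K (frontier (D i)) = 0) :
    μ (frontier {y | ∀ i, hitCount x σ 0 (T i) (D i) y = (k i : ℕ∞)}) = 0 := by
  obtain ⟨ν, F, hν, -, -, rfl⟩ := hμ
  rw [Measure.map_apply continuous_proj.measurable isClosed_frontier.measurableSet]
  refine Measure.absolutelyContinuous_of_le Measure.restrict_le_self ?_
  -- Countability keeps the union over `γ` of the null translated exceptional sets null.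
  have : Countable Γ := countable_of_Lindelof_of_discrete
  have hae : ∀ᵐ g ∂ν, ∀ i κ, ∀ γ : Γ, (w κ)⁻¹ * γ * g ∉ exceptionalSet (T i) (D i) κ := by
    rw [ae_all_iff]; intro i
    rw [ae_all_iff]; intro κ
    rw [ae_all_iff]; intro γ
    have h0 : ν ((fun g => (w κ)⁻¹ * γ * g) ⁻¹' exceptionalSet (T i) (D i) κ) = 0 := by
      rw [measure_preimage_mul]
      exact measure_exceptionalSet_eq_zero ν (hDbdry i) (T i) κ
    exact measure_eq_zero_iff_ae_notMem.1 h0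
  rw [measure_eq_zero_iff_ae_notMem]
  filter_upwards [hae] with g hg
  refine proj_notMem_frontier ?_
  filter_upwards [eventually_all.2 fun i => eventually_encard_hitTimesIn_eq hper hw (hDsub i)
    fun κ γ hγ => hg i κ ⟨γ, hγ⟩] with g' hg'
  refine forall_congr' fun i => ?_
  have hfin := finite_hitTimes hw (fun κ => (hper κ 1).2 ⟨1, by simp⟩) σ 0
  rw [hitCount_eq_encard (hfin _), hitCount_eq_encard (hfin _), hg' i]

end Limit

end

end HorocycleFlow

open HorocycleFlow
theorem mainTheorem7 (Γ : Subgroup SL2R) [DiscreteTopology Γ] (hneg : -1 ∈ Γ)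
    (μ : Measure (UnitTangent Γ)) (hμ : IsLiouville Γ μ)
    {K : ℕ} (c : Fin K → OnePoint ℝ) (hc : IsCuspSystem Γ c)
    (x : Fin K → UnitTangent Γ) (hx : ∀ κ, OnUnitHorocycle (c κ) (x κ))
    (lam : Measure (UnitTangent Γ)) [IsProbabilityMeasure lam] (hlam : Admissible μ lam)
    (σ : Fin K → ℝ) (N : ℕ) (k : Fin N → ℕ)
    (T : Fin N → ℝ) (hTpos : ∀ i, 0 < T i) (hTmono : Monotone T)
    (D : Fin N → Set (ℝ × ℝ × Fin K)) (hDsub : ∀ i, D i ⊆ sectionParam σ)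
    (hDmeas : ∀ i, MeasurableSet (D i)) (hDbdry : ∀ i, sheetVolume K (frontier (D i)) = 0) :
    Tendsto
      (fun R : ℝ => lam {x₀ | ∀ i, hitCount x σ R (T i) (D i) x₀ = (k i : ℕ∞)}) atTop
      (𝓝 (μ {y | ∀ i, hitCount x σ 0 (T i) (D i) y = (k i : ℕ∞)})) := by
  choose w hw using fun κ => proj_surjective (x κ)
  have hper : ∀ κ (s : ℝ), w κ * stableMatrix s * (w κ)⁻¹ ∈ Γ ↔ ∃ m : ℤ, s = m := fun κ s => by
    rw [← stableFlow_proj_eq_iff, hw]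
    exact (hx κ).2 s
  have hflow := hitCount_geodesicFlow hw (fun κ => (hper κ 1).2 ⟨1, by simp⟩) σ
  -- It remains to identify the event at height `R` with the `geodesicFlow R`-image of the limiting
  -- event.
  convert hlam.tendsto_of_measure_frontier_eq_zero
    (measure_frontier_hitCount_eq_zero hw hper hμ σ k T hDsub hDbdry) using 3 with R
  ext y
  constructor
  · intro hy
    have hinv : geodesicFlow R (geodesicFlow (-R) y) = y := by
      rw [geodesicFlow_geodesicFlow, neg_add_cancel, geodesicFlow_zero]
    refine ⟨geodesicFlow (-R) y, fun i => ?_, hinv⟩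
    rw [← hflow R, hinv]
    exact hy i
  · rintro ⟨y, hy, rfl⟩ i
    rw [hflow]
    exact hy i
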